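/- All fields have characteristic zero. A differential field $F$ is a field with one derivation $'$; its constants are the elements $c$ with $c'=0$. If $\theta,\eta\in F$, $\eta\neq 0$ and $\theta'=\eta'/\eta$, then $\theta$ is called a logarithm of $\eta$, written $\log\eta$, and $\eta$ is called an exponential of $\theta$, written $e^{\theta}$. A differential field extension $E$ of $F$ is a logarithmic extension of $F$ if every constant of $E$ lies in $F$ and there are finitely many $h_1,\dots,h_m\in F\setminus\{0\}$ such that $E=F(\log h_1,\dots,\log h_m)$ for some logarithms $\log h_1,\dots,\log h_m\in E$. An element $v$ of a differential field $F$ admits a $\mathcal{DEL}$-expression over $F$ if there are finite (possibly empty) index sets $I,J,K$ and elements $r_i\in F$, $g_i\in F\setminus\{0,1\}$ ($i\in I$), elements $u_j,\log u_j\in F$ with $u_j\ne 0$, $\log u_j\neq 0$ and constants $a_j\in F$ ($j\in J$), elements $v_k,e^{-v_k^2}\in F$ and constants $b_k\in F$ ($k\in K$), and $w\in F$ such that $$v=\sum_{i\in I} r_i\frac{g_i'}{g_i}+\sum_{j\in J}a_j\frac{u_j'}{\log u_j}+\sum_{k\in K}b_kv_k'e^{-v_k^2}+w',\qquad (*)$$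 where for each $i\in I$ the derivative $r_i'$ is a finite sum $\sum_{l}c_{il}h_{il}'/h_{il}$ with constants $c_{il}\in F$ and elements $h_{il}\in F\setminus\{0\}$. The expression is special if for each $i\in I$ there is a constant $c_i\in F$ with $r_i'=c_i(1-g_i)'/(1-g_i)$. **Theorem.** Let $F$ be a differential field and $v\in F$. If $v$ admits a special $\mathcal{DEL}$-expression over some logarithmic extension $E$ of $F$, then $v$ admits a $\mathcal{DEL}$-expression $(*)$ over $F$ (with all $r_i,g_i,a_j,u_j,\log u_j,b_k,v_k,e^{-v_k^2},w$ in $F$) for which there are constants $c_i\in F$ $(i\in I)$ and $c_{il}\in F$ $(i,l\in I)$ with $c_{il}=c_{li}$ and $$r_i'=c_i\frac{(1-g_i)'}{1-g_i}+\sum_{l\in I}c_{il}\frac{g_l'}{g_l}\qquad\text{for all } i\in I.$$ -/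

import Mathlib

open scoped Differential

/-- `θ` is a logarithm of `η` (equivalently, `η` is an exponential of `θ`) in the differential
field `F`: `η ≠ 0` and `θ' = η' / η`. -/
def IsLogarithm {F : Type*} [Field F] [Differential F] (θ η : F) : Prop :=
  η ≠ 0 ∧ θ′ = η′ / η

/-- `E` is a logarithmic extension of the differential field `F`: every constant of `E` lies in
`F`, and `E = F(log h₁, …, log hₘ)` for some `h₁, …, hₘ ∈ F`. -/
def IsLogarithmicExtension (F E : Type*) [Field F] [Differential F] [Field E] [Differential E]
    [Algebra F E] [DifferentialAlgebra F E] : Prop :=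
  Differential.ContainConstants F E ∧
    ∃ (m : ℕ) (h : Fin m → F) (θ : Fin m → E),
      (∀ i, IsLogarithm (θ i) (algebraMap F E (h i))) ∧
        IntermediateField.adjoin F (Set.range θ) = ⊤

/-- A `DEL`-expression over the differential field `F` for the element `v ∈ F`:
`v = ∑ rᵢ gᵢ'/gᵢ + ∑ aⱼ uⱼ'/log uⱼ + ∑ bₖ vₖ' exp(-vₖ²) + w'`, where each `rᵢ'` is a
linear combination, with constant coefficients, of logarithmic derivatives of elements of `F`. -/
structure DELExpression (F : Type*) [Field F] [Differential F] (v : F) where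
  /-- number of indices in `I` -/
  nI : ℕ
  /-- number of indices in `J` -/
  nJ : ℕ
  /-- number of indices in `K` -/
  nK : ℕ
  r : Fin nI → F
  g : Fin nI → F
  a : Fin nJ → F
  u : Fin nJ → F
  /-- `logu j` is the chosen logarithm of `u j` -/
  logu : Fin nJ → F
  b : Fin nK → F
  vk : Fin nK → F
  /-- `expv k` is the chosen exponential of `-(vk k)²` -/
  expv : Fin nK → F
  w : F
  g_ne_zero : ∀ i, g i ≠ 0
  g_ne_one : ∀ i, g i ≠ 1
  a_const : ∀ j, (a j)′ = 0
  logu_log : ∀ j, IsLogarithm (logu j) (u j)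
  logu_ne_zero : ∀ j, logu j ≠ 0
  b_const : ∀ k, (b k)′ = 0
  expv_exp : ∀ k, IsLogarithm (-((vk k) ^ 2)) (expv k)
  r_deriv : ∀ i, ∃ (n : ℕ) (c h : Fin n → F), (∀ l, (c l)′ = 0) ∧ (∀ l, h l ≠ 0) ∧
    (r i)′ = ∑ l, c l * ((h l)′ / h l)
  eq : v = ∑ i, r i * ((g i)′ / g i) + ∑ j, a j * ((u j)′ / logu j)
    + ∑ k, b k * (vk k)′ * expv k + w′

namespace DELExpression

variable {F : Type*} [Field F] [Differential F] {v : F}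

/-- The expression is special: `rᵢ' = cᵢ (1 - gᵢ)'/(1 - gᵢ)` with each `cᵢ` constant. -/
def IsSpecial (D : DELExpression F v) : Prop :=
  ∀ i, ∃ c : F, c′ = 0 ∧ (D.r i)′ = c * ((1 - D.g i)′ / (1 - D.g i))

end DELExpression

/-! Build `E` from `F` by adjoining one logarithm `t` of some `h` in `F` at a time. An algebraic `t`
already lies in the current field `K`, so only transcendental `t` matter.

Two facts start the descent. By a pole argument in `K(t)`, any element of `E` that has a logarithm
in `E` lies in `F` (`mem_range_of_isLogarithm`). In a special expression with `cᵢ ≠ 0`, `rᵢ / cᵢ` is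
a logarithm of `1 - gᵢ`, so `gᵢ` lies in `F`; with `cᵢ = 0`, the term is a constant times a
logarithmic derivative. Hence only the `rᵢ` and the remaining terms have to be brought down.

In one step from `K(t)` to `K` (`HasSymmExpression.descend`), `rᵢ'` lies in `K`, so `rᵢ = eᵢ t + fᵢ`
with `eᵢ` constant. Modulo fractions of negative degree in `t`, every other term is a term over `K`
or a derivative. Comparing polynomial parts gives a polynomial `P` with `P(t)'` affine in `t`, so
`P` is quadratic with constant `P₂`. Its linear coefficient becomes the new `r`, attached to `g =
h`, and `P₁' = -∑ eᵢ gᵢ'/gᵢ - 2 P₂ h'/h`, `fᵢ' = rᵢ' - eᵢ h'/h`. The same `-eᵢ` occurs in both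
formulas, which is why the matrix stays symmetric. -/

section LogarithmicDescent

open Polynomial Differential

/-! ### Local rings of `K(t)` at irreducible polynomials. -/

section Regular

variable {K E : Type*} [Field K] [Field E] [Algebra K E]

/-- The subring of `E` of the fractions in `t` that are regular at the irreducible polynomial `π`. -/
def regularSubring (t : E) {π : K[X]} (hπ : Prime π) : Subring E where
  carrier := {x | ∃ p q : K[X], ¬ π ∣ q ∧ aeval t q ≠ 0 ∧ x = aeval t p / aeval t q}
  mul_mem' := by
    rintro _ _ ⟨p, q, hq, h, rfl⟩ ⟨p', q', hq', h', rfl⟩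
    refine ⟨p * p', q * q', fun hd => (hπ.dvd_or_dvd hd).elim hq hq', ?_, ?_⟩
    · simp [h, h']
    · simp [div_mul_div_comm]
  one_mem' := ⟨1, 1, fun h => hπ.not_isUnit (isUnit_of_dvd_one h), by simp⟩
  add_mem' := by
    rintro _ _ ⟨p, q, hq, h, rfl⟩ ⟨p', q', hq', h', rfl⟩
    refine ⟨p * q' + q * p', q * q', fun hd => (hπ.dvd_or_dvd hd).elim hq hq', ?_, ?_⟩
    · simp [h, h']
    · simp [div_add_div _ _ h h']
  zero_mem' := ⟨0, 1, fun h => hπ.not_isUnit (isUnit_of_dvd_one h), by simp⟩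
  neg_mem' := by
    rintro _ ⟨p, q, hq, h, rfl⟩
    exact ⟨-p, q, hq, h, by simp [neg_div]⟩

lemma aeval_mem_regularSubring {t : E} {π : K[X]} (hπ : Prime π) (p : K[X]) :
    aeval t p ∈ regularSubring t hπ :=
  ⟨p, 1, fun h => hπ.not_isUnit (isUnit_of_dvd_one h), by simp, by simp⟩

lemma inv_aeval_mem_regularSubring {t : E} (htr : Transcendental K t) {π : K[X]} (hπ : Prime π) {q : K[X]}
    (hq : ¬ π ∣ q) : (aeval t q)⁻¹ ∈ regularSubring t hπ :=
  ⟨1, q, hq, (transcendental_iff.mp htr q).mt (by rintro rfl; simp at hq), by simp⟩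

end Regular

/-! ### Derivation on `K[t]` and poles in `K(t)` when `t'` lies in `K`. -/

section PrimitiveExtension

variable {K E : Type*} [Field K] [Differential K] [Field E] [Differential E] [Algebra K E]
  [DifferentialAlgebra K E]

lemma coeff_implicitDeriv_C (τ : K) (p : K[X]) (n : ℕ) :
    (implicitDeriv (C τ) p).coeff n = (p.coeff n)′ + τ * (p.coeff (n + 1) * (n + 1)) := by
  simp [implicitDeriv, coeff_derivative]

lemma deriv_aeval_of_primitive {t : E} {τ : K} (ht : t′ = algebraMap K E τ) (p : K[X]) :
    (aeval t p)′ = aeval t (implicitDeriv (C τ) p) :=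
  deriv_aeval_eq_implicitDeriv t _ (by simpa using ht) p

lemma degree_implicitDeriv_C_le (τ : K) (p : K[X]) :
    (implicitDeriv (C τ) p).degree ≤ p.degree := by
  rw [degree_le_iff_coeff_zero]
  intro m hm
  rw [coeff_implicitDeriv_C, coeff_eq_zero_of_degree_lt hm,
    coeff_eq_zero_of_degree_lt (hm.trans (by exact_mod_cast Nat.lt_succ_self m))]
  simp

/-- The leading coefficient 1 has derivative zero, and `t' = τ` has degree 0 in `t`, so nothing
refills the top degree. -/
lemma degree_implicitDeriv_C_lt_of_monic (τ : K) {p : K[X]} (hp : p.Monic) :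
    (implicitDeriv (C τ) p).degree < p.degree := by
  refine lt_of_le_of_ne (degree_implicitDeriv_C_le τ p) fun h => ?_
  have h0 : (implicitDeriv (C τ) p).coeff p.natDegree = 0 := by
    rw [coeff_implicitDeriv_C, hp.coeff_natDegree, coeff_natDegree_succ_eq_zero]
    simp
  have := natDegree_eq_of_degree_eq h
  rw [← this, coeff_natDegree, leadingCoeff_eq_zero] at h0
  rw [h0, degree_zero] at h
  exact hp.ne_zero (degree_eq_bot.mp h.symm)

section

variable [ContainConstants K E]

/-- A primitive which is algebraic and creates no new constant lies in the base field. -/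
lemma mem_range_of_isAlgebraic_of_primitive [CharZero K] {t : E} {τ : K}
    (ht : t′ = algebraMap K E τ) (halg : IsAlgebraic K t) : t ∈ (algebraMap K E).range := by
  have hint := halg.isIntegral
  have hm := minpoly.monic hint
  have h0 : implicitDeriv (C τ) (minpoly K t) = 0 := by
    by_contra hne
    refine (minpoly.degree_le_of_ne_zero K t hne ?_).not_gt
      (degree_implicitDeriv_C_lt_of_monic τ hm)
    rw [← deriv_aeval_of_primitive ht, minpoly.aeval, map_zero]
  obtain ⟨n, hn⟩ : ∃ n, (minpoly K t).natDegree = n + 1 :=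
    ⟨_, (Nat.succ_pred_eq_of_pos (minpoly.natDegree_pos hint)).symm⟩
  -- The coefficient just below the top gives `pₙ' + (n + 1) τ = 0`, so `pₙ + (n + 1) t` is a
  -- constant and hence lies in `K`.
  have h1 := congrArg (fun q => coeff q n) h0
  simp only [coeff_implicitDeriv_C, coeff_zero] at h1
  rw [← hn, hm.coeff_natDegree, one_mul] at h1
  have hc : (algebraMap K E ((minpoly K t).coeff n) + (n + 1 : ℕ) * t)′ = 0 := by
    have := congrArg (algebraMap K E) h1
    simp only [map_add, map_mul, map_zero, map_natCast, map_one] at this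
    rw [map_add, deriv_algebraMap, Derivation.leibniz, ht, Derivation.map_natCast]
    simp only [smul_eq_mul, Nat.cast_add, Nat.cast_one]
    linear_combination this
  obtain ⟨c, hc⟩ := mem_range_of_deriv_eq_zero K hc
  refine ⟨(c - (minpoly K t).coeff n) / ((n + 1 : ℕ) : K), ?_⟩
  have : ((n + 1 : ℕ) : E) ≠ 0 := by
    rw [← map_natCast (algebraMap K E), _root_.map_ne_zero]
    exact_mod_cast n.succ_ne_zero
  rw [map_div₀, map_sub, hc, map_natCast, div_eq_iff this]
  ring

variable {t : E} {τ : K}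

lemma natDegree_eq_zero_of_implicitDeriv_C_eq_zero (ht : t′ = algebraMap K E τ)
    (htr : Transcendental K t) {p : K[X]} (hp : implicitDeriv (C τ) p = 0) :
    p.natDegree = 0 := by
  obtain ⟨c, hc⟩ := mem_range_of_deriv_eq_zero K
    (show (aeval t p)′ = 0 by rw [deriv_aeval_of_primitive ht, hp, map_zero])
  have : p = C c := transcendental_iff_injective.mp htr (by simp [hc])
  rw [this, natDegree_C]

/-- Differentiation lowers the degree by at most one: a larger drop would yield a non-constant
polynomial in `t` that is a constant of `E`. -/
lemma natDegree_le_of_natDegree_implicitDeriv_C_le [CharZero K] (ht : t′ = algebraMap K E τ)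
    (htr : Transcendental K t) {p : K[X]} {n : ℕ}
    (hp : (implicitDeriv (C τ) p).natDegree ≤ n) : p.natDegree ≤ n + 1 := by
  by_contra! hlt
  obtain ⟨m, hm⟩ : ∃ m, p.natDegree = m + 1 := ⟨p.natDegree - 1, by omega⟩
  set a := p.coeff (m + 1) with ha
  have ha0 : a ≠ 0 := by
    rw [ha, ← hm, coeff_natDegree, Ne, leadingCoeff_eq_zero]
    rintro rfl
    simp at hm
  have h1 : a′ = 0 := by
    have := coeff_eq_zero_of_natDegree_lt (show (implicitDeriv (C τ) p).natDegree < m + 1 by omega)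
    rwa [coeff_implicitDeriv_C, coeff_eq_zero_of_natDegree_lt (by omega : p.natDegree < m + 1 + 1),
      zero_mul, mul_zero, add_zero] at this
  have h2 := coeff_eq_zero_of_natDegree_lt (show (implicitDeriv (C τ) p).natDegree < m by omega)
  rw [coeff_implicitDeriv_C, ← ha] at h2
  -- The vanishing of the two top coefficients of the derivative says that `a' = 0` and `p_m' + (m +
  -- 1) a τ = 0`, that is, `q(t)' = 0`.
  set q : K[X] := C (a * (m + 1)) * X + C (p.coeff m) with hq
  have hq0 : implicitDeriv (C τ) q = 0 := by
    have h3 : (a * ((m : K) + 1))′ = 0 := by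
      rw [Derivation.leibniz, h1, map_add, Derivation.map_natCast, Derivation.map_one_eq_zero]
      simp
    rw [hq, map_add, Derivation.leibniz, implicitDeriv_C, implicitDeriv_C, implicitDeriv_X, h3]
    have h4 : C ((p.coeff m)′ + τ * (a * (m + 1))) = 0 := by rw [h2, C_0]
    rw [C_add, C_mul] at h4
    simp only [C_0, smul_eq_mul]
    linear_combination h4
  have hd := natDegree_eq_zero_of_implicitDeriv_C_eq_zero ht htr hq0
  rw [natDegree_linear (mul_ne_zero ha0 (by exact_mod_cast m.succ_ne_zero))] at hd
  exact one_ne_zero hd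

lemma implicitDeriv_C_ne_zero_of_irreducible (ht : t′ = algebraMap K E τ)
    (htr : Transcendental K t) {p : K[X]} (hp : Irreducible p) : implicitDeriv (C τ) p ≠ 0 :=
  fun h => hp.natDegree_pos.ne' (natDegree_eq_zero_of_implicitDeriv_C_eq_zero ht htr h)

/-- The derivative is nonzero, since no new constants arise, and has smaller degree. Thus a pole at
`p` always gains exactly one order under differentiation. -/
lemma not_dvd_implicitDeriv_C (ht : t′ = algebraMap K E τ)
    (htr : Transcendental K t) {p : K[X]} (hp : Irreducible p) (hm : p.Monic) :
    ¬ p ∣ implicitDeriv (C τ) p := fun h =>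
  (degree_le_of_dvd h (implicitDeriv_C_ne_zero_of_irreducible ht htr hp)).not_gt
    (degree_implicitDeriv_C_lt_of_monic τ hm)

end

/-! ### Pole orders of derivatives and logarithmic derivatives. -/

section Local

variable {t : E} {τ : K} {π : K[X]}

lemma deriv_mem_regularSubring (ht : t′ = algebraMap K E τ) (hπ : Prime π) {x : E}
    (hx : x ∈ regularSubring t hπ) : x′ ∈ regularSubring t hπ := by
  obtain ⟨p, q, hq, h, rfl⟩ := hx
  refine ⟨q * implicitDeriv (C τ) p - p * implicitDeriv (C τ) q, q ^ 2,
    fun hd => hq (hπ.dvd_of_dvd_pow hd), by simpa using h, ?_⟩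
  rw [Derivation.leibniz_div, deriv_aeval_of_primitive ht, deriv_aeval_of_primitive ht]
  simp [div_eq_inv_mul]

/-- The logarithmic derivative of a monic irreducible polynomial has a pole there. -/
lemma natCast_mul_logDeriv_notMem_regularSubring [CharZero K] [ContainConstants K E]
    (ht : t′ = algebraMap K E τ)
    (htr : Transcendental K t) (hπ : Prime π) (hm : π.Monic) {n : ℕ} (hn : n ≠ 0) :
    (n : E) * ((aeval t π)′ / aeval t π) ∉ regularSubring t hπ := by
  rintro ⟨p, q, hq, h, he⟩
  have hπ0 : aeval t π ≠ 0 := (transcendental_iff.mp htr π).mt hπ.ne_zero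
  rw [deriv_aeval_of_primitive ht, ← mul_div_assoc, div_eq_div_iff hπ0 h] at he
  have : (C (n : K) * implicitDeriv (C τ) π) * q = p * π :=
    transcendental_iff_injective.mp htr (by simpa using he)
  rcases hπ.dvd_or_dvd (Dvd.intro_left _ this.symm) with hd | hd
  · rcases hπ.dvd_or_dvd hd with hd | hd
    · refine hπ.not_isUnit (isUnit_of_dvd_unit hd (isUnit_C.mpr ?_))
      exact (Nat.cast_ne_zero.mpr hn).isUnit
    · exact not_dvd_implicitDeriv_C ht htr hπ.irreducible hm hd
  · exact hq hd

/-- The derivative of an element of `K(t)` does not have a simple pole at `π`. -/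
lemma not_deriv_eq_logDeriv_add [CharZero K] [ContainConstants K E]
    (ht : t′ = algebraMap K E τ) (htr : Transcendental K t) (hπ : Prime π) (hm : π.Monic)
    {n : ℕ} (hn : n ≠ 0) {x y : E} (hx : ∃ p q : K[X], x = aeval t p / aeval t q)
    (hy : y ∈ regularSubring t hπ) :
    x′ ≠ (n : E) * ((aeval t π)′ / aeval t π) + y := by
  intro he
  have hnot {n : ℕ} (hn : n ≠ 0) := natCast_mul_logDeriv_notMem_regularSubring ht htr hπ hm hn
  set O := regularSubring t hπ
  have hπ0 : aeval t π ≠ 0 := (transcendental_iff.mp htr π).mt hπ.ne_zero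
  by_cases hxO : x ∈ O
  · apply hnot hn
    rw [eq_sub_of_add_eq he.symm]
    exact sub_mem (deriv_mem_regularSubring ht hπ hxO) hy
  obtain ⟨p, q, rfl⟩ := hx
  have hp0 : p ≠ 0 := by
    rintro rfl
    apply hxO
    simp
  have hq0 : q ≠ 0 := by
    rintro rfl
    apply hxO
    simp
  obtain ⟨q1, p1, d, hcop, rfl, rfl⟩ := UniqueFactorizationMonoid.exists_reduced_factors q hq0 p
  have hd0 : aeval t d ≠ 0 := (transcendental_iff.mp htr d).mt (left_ne_zero_of_mul hq0)
  rw [map_mul, map_mul, mul_div_mul_left _ _ hd0] at he hxO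
  obtain ⟨k, q2, hq2, rfl⟩ : ∃ k q2, ¬ π ∣ q2 ∧ q1 = π ^ k * q2 := by
    obtain ⟨q2, h1, h2⟩ := (FiniteMultiplicity.of_prime_left hπ
      (right_ne_zero_of_mul hq0)).exists_eq_pow_mul_and_not_dvd
    exact ⟨_, q2, h2, h1⟩
  have hq2O := inv_aeval_mem_regularSubring htr hπ hq2
  have hk : k ≠ 0 := by
    rintro rfl
    apply hxO
    rw [pow_zero, one_mul, div_eq_mul_inv]
    exact mul_mem (aeval_mem_regularSubring hπ p1) hq2O
  have hp1 : ¬ π ∣ p1 := fun hd => hπ.not_isUnit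
    (hcop ((dvd_pow_self π hk).mul_right q2) hd)
  obtain ⟨l, rfl⟩ := Nat.exists_eq_succ_of_ne_zero hk
  set P := aeval t π
  set ω := aeval t p1 / aeval t q2 with hω
  have hω0 : ω ≠ 0 := div_ne_zero
    ((transcendental_iff.mp htr p1).mt (by rintro rfl; simp at hp1))
    ((transcendental_iff.mp htr q2).mt (by rintro rfl; simp at hq2))
  have hωO : ω ∈ O := by
    rw [hω, div_eq_mul_inv]
    exact mul_mem (aeval_mem_regularSubring hπ p1) hq2O
  have hωO' : ω⁻¹ ∈ O := by
    rw [hω, inv_div, div_eq_mul_inv]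
    exact mul_mem (aeval_mem_regularSubring hπ q2) (inv_aeval_mem_regularSubring htr hπ hp1)
  have hPO : P ∈ O := aeval_mem_regularSubring hπ π
  have hx : aeval t p1 / aeval t (π ^ (l + 1) * q2) = ω / P ^ (l + 1) := by
    rw [map_mul, map_pow, div_div, mul_comm]
  rw [hx, Derivation.leibniz_div, Derivation.leibniz_pow] at he
  apply hnot (Nat.succ_ne_zero l)
  -- Here `x = ω / P ^ (l + 1)` with `ω` a unit of the local ring. Multiplying the equation for `x'`
  -- by `P ^ (l + 1)` isolates `(l + 1) P' / P` as a regular element, whereas it has a pole.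
  have key : ((l.succ : ℕ) : E) * (P′ / P) =
      ω⁻¹ * (ω′ - (n * (P ^ l * P′) + P ^ (l + 1) * y)) := by
    have hP' : P′ = P′ / P * P := (div_mul_cancel₀ _ hπ0).symm
    set Λ := P′ / P
    rw [hP', smul_eq_mul, inv_pow, inv_mul_eq_iff_eq_mul₀
      (pow_ne_zero 2 (pow_ne_zero (l + 1) hπ0))] at he
    rw [eq_inv_mul_iff_mul_eq₀ hω0, hP']
    apply mul_left_cancel₀ (pow_ne_zero (l + 1) hπ0)
    simp only [smul_eq_mul, nsmul_eq_mul, Nat.succ_eq_add_one, Nat.add_sub_cancel] at he ⊢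
    linear_combination -he
  rw [key]
  exact mul_mem hωO' (sub_mem (deriv_mem_regularSubring ht hπ hωO) (add_mem
    (mul_mem (natCast_mem _ _) (mul_mem (pow_mem hPO _) (deriv_mem_regularSubring ht hπ hPO)))
    (mul_mem (pow_mem hPO _) hy)))

/-- If `u = a / b` in lowest terms and `u' / u + s`, `s ∈ K`, has an antiderivative in `K(t)`, then
the numerator `a` is constant. -/
lemma isUnit_of_deriv_eq_logDeriv_add [CharZero K] [ContainConstants K E]
    (ht : t′ = algebraMap K E τ) (htr : Transcendental K t) {x : E} {s : K}
    (hx : ∃ p q : K[X], x = aeval t p / aeval t q) {a b : K[X]} (ha : a ≠ 0)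
    (hab : IsRelPrime a b)
    (he : x′ = (aeval t a)′ / aeval t a - (aeval t b)′ / aeval t b + algebraMap K E s) :
    IsUnit a := by
  by_contra hu
  obtain ⟨π, hm, hirr, hd⟩ := exists_monic_irreducible_factor a hu
  have hπ := hirr.prime
  obtain ⟨a1, h1, h2⟩ := (FiniteMultiplicity.of_prime_left hπ ha).exists_eq_pow_mul_and_not_dvd
  set n := multiplicity π a
  have hn : n ≠ 0 := by
    intro hn
    rw [hn, pow_zero, one_mul] at h1
    exact h2 (h1 ▸ hd)
  have hbπ : ¬ π ∣ b := fun hb => hirr.not_isUnit (hab hd hb)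
  have hne {p : K[X]} (hp : p ≠ 0) : aeval t p ≠ 0 := (transcendental_iff.mp htr p).mt hp
  have hreg {p : K[X]} (hp : ¬ π ∣ p) : (aeval t p)′ / aeval t p ∈ regularSubring t hπ := by
    rw [div_eq_mul_inv]
    exact mul_mem (deriv_mem_regularSubring ht hπ (aeval_mem_regularSubring hπ p))
      (inv_aeval_mem_regularSubring htr hπ hp)
  have hs : algebraMap K E s ∈ regularSubring t hπ := by
    simpa using aeval_mem_regularSubring (t := t) hπ (C s)
  refine not_deriv_eq_logDeriv_add ht htr hπ hm hn hx
    (add_mem (sub_mem (hreg h2) (hreg hbπ)) hs) (he.trans ?_)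
  have ha1 : a1 ≠ 0 := by rintro rfl; simp at h2
  have hlog : (aeval t a)′ / aeval t a =
      n * ((aeval t π)′ / aeval t π) + (aeval t a1)′ / aeval t a1 := by
    have := logDeriv_mul _ _ (pow_ne_zero n (hne hirr.ne_zero)) (hne ha1)
    rw [Differential.logDeriv_pow, ← map_pow, ← map_mul, ← h1] at this
    exact this
  rw [hlog]
  ring

/-- If `u ∈ K(t)` is such that an antiderivative of `u' / u + s`, `s ∈ K`, lies in `K(t)`, then
`u ∈ K`. -/
lemma mem_range_of_deriv_eq_logDeriv_add [CharZero K] [ContainConstants K E]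
    (ht : t′ = algebraMap K E τ) (htr : Transcendental K t) {x u : E} {s : K}
    (hx : ∃ p q : K[X], x = aeval t p / aeval t q) (hu : ∃ p q : K[X], u = aeval t p / aeval t q)
    (hu0 : u ≠ 0) (he : x′ = u′ / u + algebraMap K E s) : u ∈ (algebraMap K E).range := by
  obtain ⟨p, q, rfl⟩ := hu
  have hp0 : p ≠ 0 := by rintro rfl; simp at hu0
  obtain ⟨a, b, d, hab, rfl, rfl⟩ := UniqueFactorizationMonoid.exists_reduced_factors p hp0 q
  have hq0 : d * b ≠ 0 := by intro h; simp [h] at hu0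
  have hne {p : K[X]} (hp : p ≠ 0) : aeval t p ≠ 0 := (transcendental_iff.mp htr p).mt hp
  have ha := right_ne_zero_of_mul hp0
  have hb := right_ne_zero_of_mul hq0
  rw [map_mul, map_mul, mul_div_mul_left _ _ (hne (left_ne_zero_of_mul hp0))] at he ⊢
  have he' := he
  rw [show (aeval t a / aeval t b)′ / (aeval t a / aeval t b) = _ from
    logDeriv_div _ _ (hne ha) (hne hb)] at he'
  have hau := isUnit_of_deriv_eq_logDeriv_add ht htr hx ha hab he'
  have hbu : IsUnit b := by
    -- Negating `x` and `s` interchanges numerator and denominator.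
    refine isUnit_of_deriv_eq_logDeriv_add ht htr (x := -x) (s := -s) ?_ hb hab.symm ?_
    · obtain ⟨p, q, rfl⟩ := hx
      exact ⟨-p, q, by simp [neg_div]⟩
    · rw [map_neg, he', map_neg]
      simp only [Differential.logDeriv]
      ring
  obtain ⟨a, -, rfl⟩ := isUnit_iff.mp hau
  obtain ⟨b, -, rfl⟩ := isUnit_iff.mp hbu
  exact ⟨a / b, by simp⟩

end Local

end PrimitiveExtension

/-! ### Splitting `K(t)` into polynomials and proper fractions. -/

section ProperFractions

variable {K E : Type*} [Field K] [Field E] [Algebra K E]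

/-- The fractions in the transcendental element `t` whose numerator has smaller degree than the
denominator. -/
def properFractions {t : E} (htr : Transcendental K t) : Submodule K E where
  carrier := {x | ∃ p q : K[X], p.degree < q.degree ∧ x = aeval t p / aeval t q}
  zero_mem' := ⟨0, 1, by simp, by simp⟩
  add_mem' := by
    rintro _ _ ⟨p, q, h, rfl⟩ ⟨p', q', h', rfl⟩
    have hq : q ≠ 0 := ne_zero_of_degree_gt h
    have hq' : q' ≠ 0 := ne_zero_of_degree_gt h'
    have hne {p : K[X]} (hp : p ≠ 0) : aeval t p ≠ 0 := (transcendental_iff.mp htr p).mt hp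
    refine ⟨p * q' + q * p', q * q', ?_, by simp [div_add_div _ _ (hne hq) (hne hq')]⟩
    refine (degree_add_le _ _).trans_lt (max_lt ?_ ?_)
    · rw [degree_mul, degree_mul]
      exact WithBot.add_lt_add_right (degree_ne_bot.mpr hq') h
    · rw [degree_mul, degree_mul]
      exact WithBot.add_lt_add_left (degree_ne_bot.mpr hq) h'
  smul_mem' := by
    rintro c _ ⟨p, q, h, rfl⟩
    exact ⟨c • p, q, (degree_smul_le c p).trans_lt h, by simp [smul_div_assoc]⟩

variable {t : E} (htr : Transcendental K t)

include htr in
lemma aeval_ne_zero_of_transcendental {p : K[X]} (hp : p ≠ 0) : aeval t p ≠ 0 :=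
  (transcendental_iff.mp htr p).mt hp

lemma eq_zero_of_aeval_mem_properFractions {p : K[X]} (hp : aeval t p ∈ properFractions htr) :
    p = 0 := by
  obtain ⟨a, b, h, he⟩ := hp
  have hb : b ≠ 0 := ne_zero_of_degree_gt h
  rw [eq_div_iff (aeval_ne_zero_of_transcendental htr hb), ← map_mul] at he
  have := transcendental_iff_injective.mp htr he
  by_contra hp
  rw [← this, degree_mul] at h
  have h0 : (0 : WithBot ℕ) ≤ p.degree := zero_le_degree_iff.mpr hp
  exact absurd h (not_lt.mpr (le_add_of_nonneg_left h0))

lemma exists_aeval_add_mem_properFractions {x : E}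
    (hx : ∃ p q : K[X], x = aeval t p / aeval t q) :
    ∃ p : K[X], ∃ m ∈ properFractions htr, x = aeval t p + m := by
  obtain ⟨p, q, rfl⟩ := hx
  rcases eq_or_ne q 0 with rfl | hq
  · exact ⟨0, 0, zero_mem _, by simp⟩
  refine ⟨p / q, aeval t (p % q) / aeval t q, ⟨_, _, EuclideanDomain.mod_lt p hq, rfl⟩, ?_⟩
  have hq0 := aeval_ne_zero_of_transcendental htr hq
  rw [eq_comm, ← eq_sub_iff_add_eq', ← sub_eq_zero]
  field_simp
  rw [← map_mul, ← map_sub, ← map_sub, mul_comm q, mul_comm (p / q),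
    ← EuclideanDomain.mod_eq_sub_mul_div, sub_self]
  simp

include htr in
/-- An element of `K(t)` whose square is affine in `t` lies in `K`. -/
lemma mem_range_of_sq_eq {x : E} (hx : ∃ p q : K[X], x = aeval t p / aeval t q) {c f : K}
    (h : x ^ 2 = algebraMap K E c * t + algebraMap K E f) : x ∈ (algebraMap K E).range := by
  obtain ⟨p, q, rfl⟩ := hx
  rcases eq_or_ne q 0 with rfl | hq
  · exact ⟨0, by simp⟩
  obtain ⟨q, p, d, hqp, rfl, rfl⟩ := UniqueFactorizationMonoid.exists_reduced_factors q hq p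
  have hne {p : K[X]} (hp : p ≠ 0) : aeval t p ≠ 0 := aeval_ne_zero_of_transcendental htr hp
  have hq1 := hne (right_ne_zero_of_mul hq)
  rw [map_mul, map_mul, mul_div_mul_left _ _ (hne (left_ne_zero_of_mul hq))] at h ⊢
  rw [div_pow, div_eq_iff (pow_ne_zero 2 hq1)] at h
  have hpol : p ^ 2 = (C c * X + C f) * q ^ 2 :=
    transcendental_iff_injective.mp htr (by simpa using h)
  -- The denominator divides `p ^ 2` but is prime to `p`, so it is a unit; then `2 deg p ≤ 1` makes
  -- `p` constant as well.
  have hqu : IsUnit q := hqp.pow_right.isUnit_of_dvd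
    ((dvd_pow_self q two_ne_zero).trans (Dvd.intro_left _ hpol.symm))
  obtain ⟨b, -, rfl⟩ := isUnit_iff.mp hqu
  have hd : (p ^ 2).natDegree ≤ 1 := by
    rw [hpol, ← C_pow]
    exact (natDegree_mul_C_le _ _).trans natDegree_linear_le
  rw [natDegree_pow] at hd
  obtain ⟨a, rfl⟩ := natDegree_eq_zero.mp (by omega : p.natDegree = 0)
  exact ⟨a / b, by simp⟩

variable [Differential K] [Differential E] [DifferentialAlgebra K E] {τ : K}

lemma deriv_mem_properFractions (ht : t′ = algebraMap K E τ) {x : E}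
    (hx : x ∈ properFractions htr) : x′ ∈ properFractions htr := by
  obtain ⟨p, q, h, rfl⟩ := hx
  have hq : q ≠ 0 := ne_zero_of_degree_gt h
  refine ⟨q * implicitDeriv (C τ) p - p * implicitDeriv (C τ) q, q ^ 2, ?_, ?_⟩
  · refine (degree_sub_le _ _).trans_lt (max_lt ?_ ?_)
    · rw [degree_mul, sq, degree_mul]
      exact WithBot.add_lt_add_left (degree_ne_bot.mpr hq)
        ((degree_implicitDeriv_C_le τ p).trans_lt h)
    · rw [degree_mul, sq, degree_mul]
      refine (add_le_add_right (degree_implicitDeriv_C_le τ q) _).trans_lt ?_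
      exact WithBot.add_lt_add_right (degree_ne_bot.mpr hq) h
  · rw [Derivation.leibniz_div, deriv_aeval_of_primitive ht, deriv_aeval_of_primitive ht]
    simp [div_eq_inv_mul]

/-- Dividing by the leading coefficient leaves a monic polynomial, whose derivative has smaller
degree. -/
lemma logDeriv_aeval_sub_mem_properFractions (ht : t′ = algebraMap K E τ) {p : K[X]}
    (hp : p ≠ 0) :
    (aeval t p)′ / aeval t p - algebraMap K E (p.leadingCoeff′ / p.leadingCoeff) ∈
      properFractions htr := by
  have hl : p.leadingCoeff ≠ 0 := leadingCoeff_ne_zero.mpr hp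
  set q := C (p.leadingCoeff)⁻¹ * p with hq
  have hm : q.Monic := by
    rw [hq, mul_comm]
    exact monic_mul_leadingCoeff_inv hp
  have hpq : p = C p.leadingCoeff * q := by
    rw [hq, ← mul_assoc, ← C_mul, mul_inv_cancel₀ hl, C_1, one_mul]
  refine ⟨implicitDeriv (C τ) q, q, degree_implicitDeriv_C_lt_of_monic τ hm, ?_⟩
  have h := logDeriv_mul (algebraMap K E p.leadingCoeff) (aeval t q) (by simpa using hp)
    (aeval_ne_zero_of_transcendental htr hm.ne_zero)
  rw [logDeriv_algebraMap, ← aeval_C (A := E) t, ← map_mul, ← hpq] at h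
  simp only [Differential.logDeriv] at h
  rw [h, deriv_aeval_of_primitive ht, add_sub_cancel_left]

section

variable [CharZero K] [ContainConstants K E]

include htr in
/-- An element of `K(t)` whose derivative is in `K` is an affine function of `t`. -/
lemma exists_eq_add_of_deriv_mem_range (ht : t′ = algebraMap K E τ) {x : E} {s : K}
    (hx : ∃ p q : K[X], x = aeval t p / aeval t q) (hs : x′ = algebraMap K E s) :
    ∃ c f : K, c′ = 0 ∧ x = algebraMap K E c * t + algebraMap K E f := by
  obtain ⟨p, m, hm, rfl⟩ := exists_aeval_add_mem_properFractions htr hx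
  rw [map_add, deriv_aeval_of_primitive ht] at hs
  have hp : implicitDeriv (C τ) p - C s = 0 := by
    apply eq_zero_of_aeval_mem_properFractions htr
    rw [map_sub, aeval_C, ← hs, sub_add_cancel_left]
    exact neg_mem (deriv_mem_properFractions htr ht hm)
  have hm0 : m′ = 0 := by
    rw [sub_eq_zero.mp hp, aeval_C] at hs
    simpa using hs
  obtain ⟨k, rfl⟩ := mem_range_of_deriv_eq_zero K hm0
  -- The proper part has derivative zero, so it is an element of `K`; being also a proper fraction,
  -- it vanishes.
  have hk : algebraMap K E k = 0 := by
    have : (C k : K[X]) = 0 := eq_zero_of_aeval_mem_properFractions htr (by simpa using hm)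
    rw [C_eq_zero.mp this, map_zero]
  have hd := natDegree_le_of_natDegree_implicitDeriv_C_le ht htr (p := p) (n := 0)
    (by rw [sub_eq_zero.mp hp, natDegree_C])
  refine ⟨p.coeff 1, p.coeff 0, ?_, ?_⟩
  · have := congrArg (fun q => coeff q 1) hp
    simpa [coeff_implicitDeriv_C, coeff_C, coeff_eq_zero_of_natDegree_lt (by omega : p.natDegree < 2)]
      using this
  · conv_lhs => rw [eq_X_add_C_of_natDegree_le_one hd]
    simp [hk]

include htr in
/-- If the derivative of a polynomial in `t` is affine in `t`, the polynomial is quadratic. -/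
lemma coeff_of_implicitDeriv_C_eq (ht : t′ = algebraMap K E τ) {p : K[X]} {a b : K}
    (hp : implicitDeriv (C τ) p = C b * X + C a) :
    (p.coeff 2)′ = 0 ∧ b = (p.coeff 1)′ + 2 * p.coeff 2 * τ ∧
      a = (p.coeff 0)′ + p.coeff 1 * τ := by
  have hd := natDegree_le_of_natDegree_implicitDeriv_C_le ht htr (p := p) (n := 1)
    (by rw [hp]; exact natDegree_linear_le)
  have h (n : ℕ) := congrArg (fun q => coeff q n) hp
  have h0 := h 0
  have h1 := h 1
  have h2 := h 2
  have h3 : p.coeff 3 = 0 := coeff_eq_zero_of_natDegree_lt (by omega)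
  simp [coeff_implicitDeriv_C, coeff_C, coeff_X, h3] at h0 h1 h2
  refine ⟨h2, ?_, ?_⟩
  · rw [← h1]; ring
  · rw [← h0]; ring

end

end ProperFractions

/-! ### Descent of symmetric expressions from `K(t)` to `K`. -/

section Descent

variable {E : Type*} [Field E] [Differential E]

/-- The terms of a `DEL`-expression, with data in `S`, other than those involving a
non-constant `rᵢ`. -/
inductive IsDELTerm (S : Set E) : E → Prop
  | log {c y : E} (hc : c′ = 0) (hy : y ∈ S) (hy0 : y ≠ 0) : IsDELTerm S (c * (y′ / y))
  | li {a u l : E} (ha : a′ = 0) (hu : u ∈ S) (hl : l ∈ S) (hlog : IsLogarithm l u) (hl0 : l ≠ 0) :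
      IsDELTerm S (a * (u′ / l))
  | erf {b x e : E} (hb : b′ = 0) (hx : x ∈ S) (he : e ∈ S) (hexp : IsLogarithm (-(x ^ 2)) e) :
      IsDELTerm S (b * x′ * e)
  | deriv {w : E} (hw : w ∈ S) : IsDELTerm S w′

/-- The finite sums of terms `IsDELTerm S`. -/
def delTermSums (S : Set E) : AddSubmonoid E := AddSubmonoid.closure {x | IsDELTerm S x}

lemma IsDELTerm.mem_delTermSums {S : Set E} {x : E} (hx : IsDELTerm S x) : x ∈ delTermSums S :=
  AddSubmonoid.subset_closure hx

/-- `v` has an expression over `S` with the `gᵢ` in `A` and the `rᵢ'` given by constants and a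
symmetric matrix of constants. -/
def HasSymmExpression (A S : Set E) (v : E) : Prop :=
  ∃ (ι : Type) (_ : Fintype ι) (r g c : ι → E) (M : ι → ι → E),
    (∀ i, r i ∈ S) ∧ (∀ i, g i ∈ A ∧ g i ≠ 0 ∧ g i ≠ 1) ∧ (∀ i, (c i)′ = 0) ∧
    (∀ i l, (M i l)′ = 0) ∧ (∀ i l, M i l = M l i) ∧
    (∀ i, (r i)′ = c i * ((1 - g i)′ / (1 - g i)) + ∑ l, M i l * ((g l)′ / g l)) ∧
    v - ∑ i, r i * ((g i)′ / g i) ∈ delTermSums S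

variable {K : Type*} [Field K] [Differential K] [CharZero K] [Algebra K E]
  [DifferentialAlgebra K E] [ContainConstants K E] {t : E} {τ : K} (htr : Transcendental K t)

open IntermediateField

omit [CharZero K] in
lemma mem_range_of_mem_delTermSums {x : E} (hx : x ∈ delTermSums (Set.range (algebraMap K E))) :
    x ∈ (algebraMap K E).range := by
  have hd {x : E} (hx : x ∈ (algebraMap K E).range) : x′ ∈ (algebraMap K E).fieldRange := by
    obtain ⟨k, rfl⟩ := hx
    exact ⟨_, (deriv_algebraMap k).symm⟩
  have hc {x : E} (hx : x′ = 0) : x ∈ (algebraMap K E).fieldRange :=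
    mem_range_of_deriv_eq_zero K hx
  induction hx using AddSubmonoid.closure_induction with
  | mem x hx =>
    change x ∈ (algebraMap K E).fieldRange
    cases hx with
    | log hc' hy hy0 => exact mul_mem (hc hc') (div_mem (hd hy) hy)
    | li ha hu hl hlog hl0 => exact mul_mem (hc ha) (div_mem (hd hu) hl)
    | erf hb hx he hexp => exact mul_mem (mul_mem (hc hb) (hd hx)) he
    | deriv hw => exact hd hw
  | zero => exact zero_mem _
  | add x y _ _ hx hy => exact add_mem hx hy

/-- Each kind of term over `K(t)` is a term sum over `K` up to a derivative and a proper fraction,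
because elements of `K(t)` with a logarithm in `K(t)` lie in `K`. The proper fractions play no role
when polynomial parts are compared. -/
lemma IsDELTerm.exists_eq_add (ht : t′ = algebraMap K E τ) {x : E}
    (hx : IsDELTerm (K⟮t⟯ : Set E) x) :
    ∃ y ∈ delTermSums (Set.range (algebraMap K E)), ∃ w ∈ K⟮t⟯, ∃ m ∈ properFractions htr,
      x = y + w′ + m := by
  have hne {p : K[X]} (hp : p ≠ 0) : aeval t p ≠ 0 := aeval_ne_zero_of_transcendental htr hp
  cases hx with
  | @log c y hc hy hy0 =>
    obtain ⟨p, q, rfl⟩ := (mem_adjoin_simple_iff K y).mp hy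
    have hp : p ≠ 0 := by rintro rfl; simp at hy0
    have hq : q ≠ 0 := by rintro rfl; simp at hy0
    obtain ⟨k, rfl⟩ := mem_range_of_deriv_eq_zero K hc
    have hlc (p : K[X]) (hp : p ≠ 0) (k : E) (hk : k′ = 0) :
        k * algebraMap K E (p.leadingCoeff′ / p.leadingCoeff) ∈
          delTermSums (Set.range (algebraMap K E)) := by
      rw [map_div₀, ← deriv_algebraMap]
      exact (IsDELTerm.log hk (Set.mem_range_self _) (by simpa using hp)).mem_delTermSums
    -- Only the leading coefficients of numerator and denominator survive modulo proper fractions.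
    refine ⟨_, add_mem (hlc p hp _ hc) (hlc q hq (-algebraMap K E k) (by simp [hc])), 0, zero_mem _,
      _, (properFractions htr).smul_mem k (sub_mem
        (logDeriv_aeval_sub_mem_properFractions htr ht hp)
        (logDeriv_aeval_sub_mem_properFractions htr ht hq)), ?_⟩
    have := logDeriv_div _ _ (hne hp) (hne hq)
    simp only [Differential.logDeriv] at this
    rw [this, Algebra.smul_def, map_zero]
    ring
  | @li a u l ha hu hl hlog hl0 =>
    obtain ⟨k, rfl⟩ := mem_range_of_deriv_eq_zero K ha
    obtain ⟨u, rfl⟩ := mem_range_of_deriv_eq_logDeriv_add ht htr (s := 0)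
      ((mem_adjoin_simple_iff K _).mp hl) ((mem_adjoin_simple_iff K _).mp hu) hlog.1
      (by rw [hlog.2]; simp)
    obtain ⟨c, f, -, rfl⟩ := exists_eq_add_of_deriv_mem_range htr ht (s := u′ / u)
      ((mem_adjoin_simple_iff K _).mp hl) (by rw [hlog.2]; simp [deriv_algebraMap])
    -- The logarithm is `c t + f`. If `c = 0` the whole term is over `K`; otherwise it is an element
    -- of `K` divided by a linear polynomial, hence proper.
    by_cases hc : c = 0
    · subst hc
      refine ⟨_, (IsDELTerm.li ha (Set.mem_range_self u) (Set.mem_range.mpr ⟨f, ?_⟩) hlog hl0).mem_delTermSums, 0, zero_mem _, 0,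
        zero_mem _, by simp⟩
      simp
    · refine ⟨0, zero_mem _, 0, zero_mem _, _, ⟨C (k * u′), C c * X + C f, ?_, rfl⟩, ?_⟩
      · rw [degree_linear hc]
        exact degree_C_le.trans_lt (by norm_num)
      · simp [deriv_algebraMap, mul_div_assoc]
  | @erf b x e hb hx he hexp =>
    -- Since `-x²` is a logarithm of `e`, it follows that `e` lies in `K` and `x²` is affine in `t`;
    -- a square root of it in `K(t)` lies in `K`, so the term is over `K`.
    obtain ⟨e, rfl⟩ := mem_range_of_deriv_eq_logDeriv_add ht htr (s := 0)
      ((mem_adjoin_simple_iff K (-(x ^ 2))).mp (neg_mem (pow_mem hx 2)))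
      ((mem_adjoin_simple_iff K _).mp he) hexp.1 (by rw [hexp.2]; simp)
    obtain ⟨c, f, -, h⟩ := exists_eq_add_of_deriv_mem_range htr ht (s := e′ / e)
      ((mem_adjoin_simple_iff K (-(x ^ 2))).mp (neg_mem (pow_mem hx 2)))
      (by rw [hexp.2]; simp [deriv_algebraMap])
    have hxr := mem_range_of_sq_eq htr ((mem_adjoin_simple_iff K x).mp hx) (c := -c) (f := -f)
      (by rw [map_neg, map_neg]; linear_combination -h)
    exact ⟨_, (IsDELTerm.erf hb hxr (Set.mem_range_self e) hexp).mem_delTermSums, 0, zero_mem _, 0, zero_mem _,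
      by simp⟩
  | @deriv w hw => exact ⟨0, zero_mem _, w, hw, 0, zero_mem _, by simp⟩

lemma exists_eq_add_of_mem_delTermSums (ht : t′ = algebraMap K E τ) {x : E}
    (hx : x ∈ delTermSums (K⟮t⟯ : Set E)) :
    ∃ y ∈ delTermSums (Set.range (algebraMap K E)), ∃ w ∈ K⟮t⟯, ∃ m ∈ properFractions htr,
      x = y + w′ + m := by
  induction hx using AddSubmonoid.closure_induction with
  | mem x hx => exact IsDELTerm.exists_eq_add htr ht hx
  | zero => exact ⟨0, zero_mem _, 0, zero_mem _, 0, zero_mem _, by simp⟩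
  | add x y _ _ hx hy =>
    obtain ⟨y₁, hy₁, w₁, hw₁, m₁, hm₁, rfl⟩ := hx
    obtain ⟨y₂, hy₂, w₂, hw₂, m₂, hm₂, rfl⟩ := hy
    exact ⟨_, add_mem hy₁ hy₂, _, add_mem hw₁ hw₂, _, add_mem hm₁ hm₂, by rw [map_add]; ring⟩

include htr in
/-- A symmetric expression over `K(t)`, `t` a transcendental logarithm of an element of `A ⊆ K`,
descends to `K`. -/
lemma HasSymmExpression.descend {A : Set E} (hA : A ⊆ Set.range (algebraMap K E)) {h : K}
    (hh : algebraMap K E h ∈ A) (ht : IsLogarithm t (algebraMap K E h)) {v : E} (hv : v ∈ A)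
    (hS : HasSymmExpression A (K⟮t⟯ : Set E) v) :
    HasSymmExpression A (Set.range (algebraMap K E)) v := by
  have ht' : t′ = algebraMap K E (h′ / h) := by rw [ht.2]; simp [deriv_algebraMap]
  obtain ⟨ι, _, r, g, c, M, hr, hg, hc, hM, hsymm, hr', hmem⟩ := hS
  choose γ hγ using fun i => hA (hg i).1
  choose c₀ hc₀ using fun i => mem_range_of_deriv_eq_zero K (hc i)
  choose M₀ hM₀ using fun i l => mem_range_of_deriv_eq_zero K (hM i l)
  obtain ⟨v₀, rfl⟩ := hA hv
  have haff (i) := exists_eq_add_of_deriv_mem_range htr ht'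
    (s := c₀ i * ((1 - γ i)′ / (1 - γ i)) + ∑ l, M₀ i l * ((γ l)′ / γ l))
    ((mem_adjoin_simple_iff K _).mp (hr i)) (by
      rw [hr' i]
      simp [← hγ, ← hc₀, ← hM₀, ← deriv_algebraMap])
  choose e f he hf using haff
  obtain ⟨y, hy, w, hw, m, hm, heq⟩ := exists_eq_add_of_mem_delTermSums htr ht' hmem
  obtain ⟨y₀, rfl⟩ := mem_range_of_mem_delTermSums hy
  obtain ⟨P, m', hm', rfl⟩ := exists_aeval_add_mem_properFractions htr
    ((mem_adjoin_simple_iff K _).mp hw)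
  -- `B t + a` is `v - ∑ rᵢ gᵢ'/gᵢ - y` after inserting `rᵢ = eᵢ t + fᵢ`.
  set B : K := -∑ i, e i * ((γ i)′ / γ i) with hB
  set a : K := v₀ - ∑ i, f i * ((γ i)′ / γ i) - y₀ with ha
  have hsum : ∑ i, r i * ((g i)′ / g i) =
      -algebraMap K E B * t + algebraMap K E (v₀ - y₀ - a) := by
    have h (i) : r i * ((g i)′ / g i) = algebraMap K E (e i * ((γ i)′ / γ i)) * t +
        algebraMap K E (f i * ((γ i)′ / γ i)) := by
      rw [hf, ← hγ]
      simp only [map_mul, map_div₀, deriv_algebraMap]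
      ring
    rw [Finset.sum_congr rfl fun i _ => h i, Finset.sum_add_distrib, ← Finset.sum_mul,
      ← map_sum, ← map_sum, hB, ha, map_neg, neg_neg]
    congr 2
    ring
  have hP : implicitDeriv (C (h′ / h)) P - (C B * X + C a) = 0 := by
    apply eq_zero_of_aeval_mem_properFractions htr
    have hm2 : aeval t (implicitDeriv (C (h′ / h)) P - (C B * X + C a)) = -(m'′ + m) := by
      rw [hsum, map_add, deriv_aeval_of_primitive ht'] at heq
      simp only [map_sub, map_add, map_mul, aeval_C, aeval_X] at heq ⊢
      linear_combination -heq
    rw [hm2]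
    exact neg_mem (add_mem (deriv_mem_properFractions htr ht' hm') hm)
  obtain ⟨h2, h1, h0⟩ := coeff_of_implicitDeriv_C_eq htr ht' (sub_eq_zero.mp hP)
  have hh0 : h ≠ 0 := by simpa using ht.1
  have hh1 : h ≠ 1 := by
    rintro rfl
    obtain ⟨k, hk⟩ := mem_range_of_deriv_eq_zero K (show t′ = 0 by rw [ht']; simp)
    exact htr (hk ▸ isAlgebraic_algebraMap k)
  -- The index `none` carries `P₁ h'/h`. Its matrix row is read off from `B = P₁' + 2 P₂ h'/h`; the
  -- matching column comes from `fᵢ' = rᵢ' - eᵢ h'/h`.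
  refine ⟨Option ι, inferInstance,
    fun i => algebraMap K E (i.elim (P.coeff 1) f), fun i => algebraMap K E (i.elim h γ),
    fun i => i.elim 0 c,
    fun i l => i.elim (l.elim (-2 * algebraMap K E (P.coeff 2)) fun l => -algebraMap K E (e l))
      fun i => l.elim (-algebraMap K E (e i)) (M i), fun i => ⟨_, rfl⟩, ?_, ?_, ?_, ?_, ?_, ?_⟩
  · rintro (_ | i)
    · exact ⟨hh, ht.1, by simpa using hh1⟩
    · simpa [hγ] using hg i
  · rintro (_ | i)
    · simp
    · exact hc i
  · rintro (_ | i) (_ | l)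
    · have h3 : (2 : E)′ = 0 := by
        rw [show (2 : E) = ((2 : ℕ) : E) by norm_num, Derivation.map_natCast]
      simp [h3, deriv_algebraMap, h2]
    · simp [deriv_algebraMap, he]
    · simp [deriv_algebraMap, he]
    · exact hM i l
  · rintro (_ | i) (_ | l)
    · rfl
    · rfl
    · rfl
    · exact hsymm i l
  · rintro (_ | i)
    · have := congrArg (algebraMap K E) h1
      simp only [hB, map_neg, map_sum, map_mul, map_add, map_ofNat] at this
      simp only [Option.elim, zero_mul, zero_add, Fintype.sum_option, deriv_algebraMap, neg_mul,
        Finset.sum_neg_distrib, ← map_div₀]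
      linear_combination -this
    · have hfi : (algebraMap K E (f i))′ = (r i)′ - algebraMap K E (e i) * t′ := by
        rw [hf i, map_add, Derivation.leibniz, deriv_algebraMap (e i), he i]
        simp
      simp only [Option.elim, Fintype.sum_option, hγ]
      rw [hfi, hr' i, ht.2]
      ring
  · have hw0 : (algebraMap K E (P.coeff 0))′ ∈ delTermSums (Set.range (algebraMap K E)) :=
      (IsDELTerm.deriv (Set.mem_range_self _)).mem_delTermSums
    convert! add_mem hy hw0 using 1
    have := congrArg (algebraMap K E) h0
    simp only [ha, map_sub, map_sum, map_add, map_mul] at this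
    simp only [Option.elim, Fintype.sum_option, deriv_algebraMap, ← map_div₀]
    linear_combination this

end Descent

/-! ### Induction along the tower of logarithms. -/

section Tower

open IntermediateField

variable {F E : Type*} [Field F] [Differential F] [Field E] [Differential E] [Algebra F E]

/-- The differential field structure on an intermediate field closed under the derivation. -/
abbrev IntermediateField.differentialOfClosed (K : IntermediateField F E)
    (hK : ∀ x ∈ K, x′ ∈ K) : Differential K where
  deriv := Derivation.mk' (AddMonoidHom.toIntLinearMap
    { toFun := fun x => ⟨(x : E)′, hK x x.2⟩
      map_zero' := by ext; simp
      map_add' := fun x y => by ext; simp }) fun x y => by ext; simp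

lemma deriv_mem_adjoin_simple {K E : Type*} [Field K] [Differential K] [Field E] [Differential E]
    [Algebra K E] [DifferentialAlgebra K E] {t : E} {τ : K} (ht : t′ = algebraMap K E τ) {x : E}
    (hx : x ∈ K⟮t⟯) : x′ ∈ K⟮t⟯ := by
  obtain ⟨p, q, rfl⟩ := (mem_adjoin_simple_iff K x).mp hx
  have hmem (p : K[X]) : aeval t p ∈ K⟮t⟯ :=
    (mem_adjoin_simple_iff K _).mpr ⟨p, 1, by simp⟩
  have hd (p : K[X]) : (aeval t p)′ ∈ K⟮t⟯ := by
    rw [deriv_aeval_of_primitive ht]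
    exact hmem _
  rw [Derivation.leibniz_div]
  exact mul_mem (pow_mem (inv_mem (hmem q)) 2)
    (sub_mem (mul_mem (hmem _) (hd _)) (mul_mem (hmem _) (hd _)))

variable [CharZero F] [DifferentialAlgebra F E]

/-- A property of the differential subfields of a logarithmic extension `E` of `F` which holds for
`E` and descends along transcendental logarithms of elements of `F` holds for `F`. -/
theorem IsLogarithmicExtension.descend (hE : IsLogarithmicExtension F E) {Φ : Set E → Prop}
    (htop : Φ Set.univ)
    (step : ∀ (K : IntermediateField F E) [Differential K] [DifferentialAlgebra K E]
      [ContainConstants K E] (h : F) (t : E), IsLogarithm t (algebraMap F E h) →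
      Transcendental K t → Φ (K⟮t⟯ : Set E) → Φ (Set.range (algebraMap K E))) :
    Φ (Set.range (algebraMap F E)) := by
  classical
  obtain ⟨hconst, m, h, θ, hθ, hadj⟩ := hE
  have key := induction_on_adjoin_finset (F := F) (Finset.univ.image θ)
    (fun K => (∀ x ∈ K, x′ ∈ K) ∧ (Φ K → Φ (Set.range (algebraMap F E)))) ⟨?_, ?_⟩ ?_
  · rw [Finset.coe_image, Finset.coe_univ, Set.image_univ, hadj] at key
    exact key.2 (by simpa using htop)
  · intro x hx
    obtain ⟨a, rfl⟩ := mem_bot.mp hx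
    rw [deriv_algebraMap]
    exact mem_bot.mpr ⟨_, rfl⟩
  · rw [coe_bot]
    exact id
  · rintro K x hx ⟨hK, hΦ⟩
    obtain ⟨i, -, rfl⟩ := Finset.mem_image.mp hx
    let _ := K.differentialOfClosed hK
    have : DifferentialAlgebra K E := ⟨fun _ => rfl⟩
    have : ContainConstants K E := ⟨fun hx => by
      obtain ⟨a, rfl⟩ := mem_range_of_deriv_eq_zero F hx
      exact ⟨algebraMap F K a, rfl⟩⟩
    have ht : (θ i)′ = algebraMap K E (algebraMap F K ((h i)′ / h i)) := by
      rw [(hθ i).2, ← IsScalarTower.algebraMap_apply, map_div₀, deriv_algebraMap]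
    refine ⟨fun x hx => deriv_mem_adjoin_simple ht hx, fun hΦt => hΦ ?_⟩
    by_cases htr : Transcendental K (θ i)
    · have := step K (h i) (θ i) (hθ i) htr hΦt
      rwa [show Set.range (algebraMap K E) = (K : Set E) from Subtype.range_coe] at this
    -- An algebraic logarithm is already in `K`, so the field does not grow.
    · obtain ⟨a, ha⟩ := mem_range_of_isAlgebraic_of_primitive ht (not_not.mp htr)
      have hbot : K⟮θ i⟯ = ⊥ := adjoin_simple_eq_bot_iff.mpr (mem_bot.mpr ⟨a, ha⟩)
      rw [coe_restrictScalars, hbot, coe_bot,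
        show Set.range (algebraMap K E) = (K : Set E) from Subtype.range_coe] at hΦt
      exact hΦt

/-- In a logarithmic extension of `F` all elements having a logarithm lie in `F`. -/
lemma IsLogarithmicExtension.mem_range_of_isLogarithm (hE : IsLogarithmicExtension F E) {x u : E}
    (h : IsLogarithm x u) : u ∈ (algebraMap F E).range := by
  -- The summand `s` makes the property inductive: replacing `y = c t + f` by `f` changes the
  -- derivative by `c h₀'/h₀`, which lies in `F`.
  have := hE.descend (Φ := fun S => u ∈ S ∧ ∃ y ∈ S, ∃ s : F, y′ = u′ / u + algebraMap F E s)
    ⟨trivial, x, trivial, 0, by simpa using h.2⟩ ?_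
  · exact this.1
  · rintro K _ _ _ h₀ t ht htr ⟨hu, y, hy, s, hs⟩
    have ht' : t′ = algebraMap K E (algebraMap F K (h₀′ / h₀)) := by
      rw [ht.2, ← IsScalarTower.algebraMap_apply, map_div₀, deriv_algebraMap]
    rw [IsScalarTower.algebraMap_apply F K E] at hs
    have hy' := (mem_adjoin_simple_iff K _).mp hy
    obtain ⟨u, rfl⟩ := mem_range_of_deriv_eq_logDeriv_add ht' htr hy'
      ((mem_adjoin_simple_iff K _).mp hu) h.1 hs
    obtain ⟨c, f, hc, rfl⟩ := exists_eq_add_of_deriv_mem_range htr ht'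
      (s := u′ / u + algebraMap F K s) hy' (by
        rw [hs, map_add, map_div₀, deriv_algebraMap])
    have hc' : (algebraMap K E c)′ = 0 := by rw [deriv_algebraMap, hc, map_zero]
    have := hE.1
    obtain ⟨c₀, hc₀⟩ := mem_range_of_deriv_eq_zero F hc'
    refine ⟨⟨u, rfl⟩, _, ⟨f, rfl⟩, s - c₀ * (h₀′ / h₀), ?_⟩
    rw [map_add, Derivation.leibniz, hc', ht', ← IsScalarTower.algebraMap_apply, ← hc₀,
      ← IsScalarTower.algebraMap_apply] at hs
    simp only [smul_eq_mul, mul_zero, add_zero] at hs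
    rw [map_sub, map_mul]
    linear_combination hs

lemma IsLogarithmicExtension.hasSymmExpression (hE : IsLogarithmicExtension F E) {v : F}
    (hv : HasSymmExpression (Set.range (algebraMap F E)) Set.univ (algebraMap F E v)) :
    HasSymmExpression (Set.range (algebraMap F E)) (Set.range (algebraMap F E))
      (algebraMap F E v) := by
  refine hE.descend (Φ := fun S => HasSymmExpression (Set.range (algebraMap F E)) S _) hv ?_
  intro K _ _ _ h t ht htr hK
  refine hK.descend htr ?_ (h := algebraMap F K h) (Set.mem_range_self h) ht
    (Set.mem_range_self v)
  rintro _ ⟨a, rfl⟩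
  exact ⟨algebraMap F K a, rfl⟩

/-- If `cᵢ ≠ 0`, then `rᵢ / cᵢ` is a logarithm of `1 - gᵢ`, which puts `gᵢ` in `F`. The initial
matrix is zero. -/
lemma DELExpression.IsSpecial.hasSymmExpression (hE : IsLogarithmicExtension F E) {v : E}
    {D : DELExpression E v} (hD : D.IsSpecial) :
    HasSymmExpression (Set.range (algebraMap F E)) Set.univ v := by
  have hterm (i) : ∃ r g c : E, (g ∈ Set.range (algebraMap F E) ∧ g ≠ 0 ∧ g ≠ 1) ∧ c′ = 0 ∧
      r′ = c * ((1 - g)′ / (1 - g)) ∧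
      D.r i * ((D.g i)′ / D.g i) - r * (g′ / g) ∈ delTermSums (Set.univ : Set E) := by
    obtain ⟨c, hc, hr⟩ := hD i
    by_cases hc0 : c = 0
    -- With `cᵢ = 0` the term is moved to the remaining sum, and its index is kept by a dummy pair
    -- `r = 0`, `g = -1`, admissible because `-1` is neither 0 nor 1.
    · refine ⟨0, algebraMap F E (-1), 0, ⟨⟨_, rfl⟩, by simp, ?_⟩, by simp, by simp, ?_⟩
      · rw [← (algebraMap F E).map_one, Ne, (algebraMap F E).injective.eq_iff]
        norm_num
      · rw [zero_mul, sub_zero]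
        exact (IsDELTerm.log (by rw [hr, hc0, zero_mul]) (Set.mem_univ _) (D.g_ne_zero i)).mem_delTermSums
    · refine ⟨D.r i, D.g i, c, ⟨?_, D.g_ne_zero i, D.g_ne_one i⟩, hc, hr, by simp⟩
      obtain ⟨a, ha⟩ := hE.mem_range_of_isLogarithm (x := D.r i / c) (u := 1 - D.g i)
        ⟨sub_ne_zero.mpr (D.g_ne_one i).symm, by
          rw [Derivation.leibniz_div, hc, hr]
          simp only [smul_eq_mul, mul_zero, sub_zero]
          field_simp⟩
      exact ⟨1 - a, by rw [map_sub, ha, map_one, sub_sub_cancel]⟩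
  choose r g c hg hc hr hmem using hterm
  refine ⟨Fin D.nI, inferInstance, r, g, c, fun _ _ => 0, fun _ => trivial, hg, hc, by simp,
    by simp, by simpa using hr, ?_⟩
  have hmemJ (j) : D.a j * ((D.u j)′ / D.logu j) ∈ delTermSums (Set.univ : Set E) :=
    (IsDELTerm.li (D.a_const j) (Set.mem_univ _) (Set.mem_univ _) (D.logu_log j) (D.logu_ne_zero j)).mem_delTermSums
  have hmemK (k) : D.b k * (D.vk k)′ * D.expv k ∈ delTermSums (Set.univ : Set E) :=
    (IsDELTerm.erf (D.b_const k) (Set.mem_univ _) (Set.mem_univ _) (D.expv_exp k)).mem_delTermSums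
  have hw : D.w′ ∈ delTermSums (Set.univ : Set E) := (IsDELTerm.deriv (Set.mem_univ _)).mem_delTermSums
  have := add_mem (add_mem (add_mem (sum_mem fun i (_ : i ∈ Finset.univ) => hmem i)
    (sum_mem fun j (_ : j ∈ Finset.univ) => hmemJ j))
    (sum_mem fun k (_ : k ∈ Finset.univ) => hmemK k)) hw
  convert! this using 1
  rw [Finset.sum_sub_distrib]
  linear_combination D.eq

end Tower

/-! ### Reassembling a symmetric `DEL`-expression over `F`. -/

namespace DELExpression

variable {F : Type*} [Field F] [Differential F] {v : F}

/-- The derivatives of the `rᵢ` are combinations of the logarithmic derivatives of `1 - gᵢ` and of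
the `gₗ`, the latter with a symmetric matrix of coefficients. -/
def IsSymmetric (D : DELExpression F v) : Prop :=
  ∃ (c : Fin D.nI → F) (C : Fin D.nI → Fin D.nI → F),
    (∀ i, (c i)′ = 0) ∧ (∀ i l, (C i l)′ = 0) ∧ (∀ i l, C i l = C l i) ∧
      ∀ i, (D.r i)′ = c i * ((1 - D.g i)′ / (1 - D.g i)) + ∑ l, C i l * ((D.g l)′ / D.g l)

/-- A constant times a logarithmic derivative is an `r g'/g` term with `r' = 0`, so it enters with
zero row and column. For `y = 1`, not allowed as a `g`, the term vanishes. -/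
lemma IsSymmetric.exists_add_log {D : DELExpression F v} (hD : D.IsSymmetric) {c y : F}
    (hc : c′ = 0) (hy : y ≠ 0) :
    ∃ D' : DELExpression F (v + c * (y′ / y)), D'.IsSymmetric := by
  obtain ⟨d, M, hd, hM, hsymm, hr⟩ := hD
  by_cases hy1 : y = 1
  · exact ⟨{ D with eq := by rw [hy1]; simpa using D.eq }, d, M, hd, hM, hsymm, hr⟩
  refine ⟨{ D with
    nI := D.nI + 1
    r := Fin.cons c D.r
    g := Fin.cons y D.g
    g_ne_zero := Fin.cases hy D.g_ne_zero
    g_ne_one := Fin.cases hy1 D.g_ne_one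
    r_deriv := Fin.cases ⟨0, Fin.elim0, Fin.elim0, by simp, by simp, by simpa using hc⟩ D.r_deriv
    eq := by
      conv_lhs => rw [D.eq]
      simp only [Fin.sum_univ_succ, Fin.cons_zero, Fin.cons_succ]
      ring }, Fin.cons 0 d, Fin.cons 0 fun i => Fin.cons 0 (M i), ?_, ?_, ?_, ?_⟩
  · exact Fin.cases (by simp) (by simpa using hd)
  · exact Fin.cases (by simp) fun i => Fin.cases (by simp) (by simpa using hM i)
  · exact Fin.cases (Fin.cases (by simp) (by simp)) fun i =>
      Fin.cases (by simp) (by simpa using hsymm i)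
  · exact Fin.cases (by simpa using hc) fun i => by simpa [Fin.sum_univ_succ] using hr i

lemma IsSymmetric.exists_add_li {D : DELExpression F v} (hD : D.IsSymmetric) {a u l : F}
    (ha : a′ = 0) (hlog : IsLogarithm l u) (hl : l ≠ 0) :
    ∃ D' : DELExpression F (v + a * (u′ / l)), D'.IsSymmetric := by
  refine ⟨{ D with
    nJ := D.nJ + 1
    a := Fin.cons a D.a
    u := Fin.cons u D.u
    logu := Fin.cons l D.logu
    a_const := Fin.cases ha D.a_const
    logu_log := Fin.cases hlog D.logu_log
    logu_ne_zero := Fin.cases hl D.logu_ne_zero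
    eq := by
      conv_lhs => rw [D.eq]
      simp only [Fin.sum_univ_succ, Fin.cons_zero, Fin.cons_succ]
      ring }, hD⟩

lemma IsSymmetric.exists_add_erf {D : DELExpression F v} (hD : D.IsSymmetric) {b x e : F}
    (hb : b′ = 0) (hexp : IsLogarithm (-(x ^ 2)) e) :
    ∃ D' : DELExpression F (v + b * x′ * e), D'.IsSymmetric := by
  refine ⟨{ D with
    nK := D.nK + 1
    b := Fin.cons b D.b
    vk := Fin.cons x D.vk
    expv := Fin.cons e D.expv
    b_const := Fin.cases hb D.b_const
    expv_exp := Fin.cases hexp D.expv_exp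
    eq := by
      conv_lhs => rw [D.eq]
      simp only [Fin.sum_univ_succ, Fin.cons_zero, Fin.cons_succ]
      ring }, hD⟩

lemma IsSymmetric.exists_add_deriv {D : DELExpression F v} (hD : D.IsSymmetric) (w : F) :
    ∃ D' : DELExpression F (v + w′), D'.IsSymmetric :=
  ⟨{ D with
    w := D.w + w
    eq := by
      conv_lhs => rw [D.eq]
      rw [map_add, add_assoc] }, hD⟩

lemma exists_isSymmetric_of_sum {ι : Type*} [Fintype ι] {r g c : ι → F} {M : ι → ι → F}
    (hg : ∀ i, g i ≠ 0 ∧ g i ≠ 1) (hc : ∀ i, (c i)′ = 0) (hM : ∀ i l, (M i l)′ = 0)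
    (hsymm : ∀ i l, M i l = M l i)
    (hr : ∀ i, (r i)′ = c i * ((1 - g i)′ / (1 - g i)) + ∑ l, M i l * ((g l)′ / g l)) :
    ∃ D : DELExpression F (∑ i, r i * ((g i)′ / g i)), D.IsSymmetric := by
  let e := Fintype.equivFin ι
  have hr' (i) : (r (e.symm i))′ = c (e.symm i) * ((1 - g (e.symm i))′ / (1 - g (e.symm i))) +
      ∑ l, M (e.symm i) (e.symm l) * ((g (e.symm l))′ / g (e.symm l)) := by
    rw [hr, e.symm.sum_comp fun l => M (e.symm i) l * ((g l)′ / g l)]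
  exact ⟨{
    nI := Fintype.card ι
    nJ := 0
    nK := 0
    r := r ∘ e.symm
    g := g ∘ e.symm
    a := Fin.elim0
    u := Fin.elim0
    logu := Fin.elim0
    b := Fin.elim0
    vk := Fin.elim0
    expv := Fin.elim0
    w := 0
    g_ne_zero := fun i => (hg _).1
    g_ne_one := fun i => (hg _).2
    a_const := fun i => i.elim0
    logu_log := fun i => i.elim0
    logu_ne_zero := fun i => i.elim0
    b_const := fun i => i.elim0
    expv_exp := fun i => i.elim0
    r_deriv := fun i => ⟨Fintype.card ι + 1, Fin.cons (c (e.symm i)) (M (e.symm i) ∘ e.symm),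
      Fin.cons (1 - g (e.symm i)) (g ∘ e.symm), Fin.cases (hc _) fun l => hM _ _,
      Fin.cases (sub_ne_zero.mpr (hg _).2.symm) fun l => (hg _).1, by
        simpa [Fin.sum_univ_succ] using hr' i⟩
    eq := by
      rw [← e.symm.sum_comp]
      simp },
    c ∘ e.symm, fun i l => M (e.symm i) (e.symm l), fun _ => hc _, fun _ _ => hM _ _,
    fun _ _ => hsymm _ _, hr'⟩

variable {E : Type*} [Field E] [Differential E] [Algebra F E] [DifferentialAlgebra F E]

/-- The element `z` is chosen before `v` and `D`, so that the summands can be absorbed successively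
into varying expressions. -/
lemma exists_add_of_mem_delTermSums {y : E}
    (hy : y ∈ delTermSums (Set.range (algebraMap F E)))
    (hconst : ContainConstants F E) :
    ∃ z : F, algebraMap F E z = y ∧ ∀ {v : F} {D : DELExpression F v}, D.IsSymmetric →
      ∃ D' : DELExpression F (v + z), D'.IsSymmetric := by
  have hinj := (algebraMap F E).injective
  have hc {x : E} (hx : x′ = 0) : ∃ a : F, algebraMap F E a = x ∧ a′ = 0 := by
    obtain ⟨a, rfl⟩ := mem_range_of_deriv_eq_zero F hx
    exact ⟨a, rfl, by simpa [deriv_algebraMap] using hx⟩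
  have hlog {x y : F} (h : IsLogarithm (algebraMap F E x) (algebraMap F E y)) :
      IsLogarithm x y :=
    ⟨by simpa using h.1, hinj (by simpa [deriv_algebraMap] using h.2)⟩
  induction hy using AddSubmonoid.closure_induction with
  | mem x hx =>
    cases hx with
    | log h hy hy0 =>
      obtain ⟨c, rfl, h'⟩ := hc h
      obtain ⟨y, rfl⟩ := hy
      exact ⟨c * (y′ / y), by simp [deriv_algebraMap],
        fun hD => hD.exists_add_log h' (by simpa using hy0)⟩
    | li h hu hl hl' hl0 =>
      obtain ⟨a, rfl, h'⟩ := hc h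
      obtain ⟨u, rfl⟩ := hu
      obtain ⟨l, rfl⟩ := hl
      exact ⟨a * (u′ / l), by simp [deriv_algebraMap],
        fun hD => hD.exists_add_li h' (hlog hl') (by simpa using hl0)⟩
    | erf h hx he hexp =>
      obtain ⟨b, rfl, h'⟩ := hc h
      obtain ⟨x, rfl⟩ := hx
      obtain ⟨e, rfl⟩ := he
      exact ⟨b * x′ * e, by simp [deriv_algebraMap],
        fun hD => hD.exists_add_erf h' (hlog (by simpa using hexp))⟩
    | deriv hw =>
      obtain ⟨w, rfl⟩ := hw
      exact ⟨w′, by simp [deriv_algebraMap], fun hD => hD.exists_add_deriv w⟩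
  | zero => exact ⟨0, by simp, fun {v D} hD => by rw [add_zero]; exact ⟨D, hD⟩⟩
  | add x y _ _ hx hy =>
    obtain ⟨z₁, rfl, h₁⟩ := hx
    obtain ⟨z₂, rfl, h₂⟩ := hy
    refine ⟨z₁ + z₂, by simp, fun hD => ?_⟩
    obtain ⟨D₁, hD₁⟩ := h₁ hD
    rw [← add_assoc]
    exact h₂ hD₁

end DELExpression

/-- A symmetric expression in the range of `algebraMap F E` comes from a symmetric
`DEL`-expression over `F`. -/
lemma HasSymmExpression.exists_isSymmetric {F E : Type*} [Field F] [Differential F] [Field E]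
    [Differential E] [Algebra F E] [DifferentialAlgebra F E] [ContainConstants F E] {v : F}
    (hv : HasSymmExpression (Set.range (algebraMap F E)) (Set.range (algebraMap F E))
      (algebraMap F E v)) :
    ∃ D : DELExpression F v, D.IsSymmetric := by
  obtain ⟨ι, _, r, g, c, M, hr, hg, hc, hM, hsymm, hr', hmem⟩ := hv
  have hinj := (algebraMap F E).injective
  choose r₀ hr₀ using hr
  choose g₀ hg₀ using fun i => (hg i).1
  choose c₀ hc₀ using fun i => mem_range_of_deriv_eq_zero F (hc i)
  choose M₀ hM₀ using fun i l => mem_range_of_deriv_eq_zero F (hM i l)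
  obtain rfl := funext hr₀
  obtain rfl := funext hg₀
  obtain rfl := funext hc₀
  obtain rfl : (fun i l => algebraMap F E (M₀ i l)) = M := funext fun i => funext (hM₀ i)
  obtain ⟨z, hz, hadd⟩ := DELExpression.exists_add_of_mem_delTermSums hmem inferInstance
  obtain ⟨D, hD⟩ := DELExpression.exists_isSymmetric_of_sum (r := r₀) (g := g₀) (c := c₀) (M := M₀)
    (fun i => by simpa using (hg i).2) (fun i => by simpa [deriv_algebraMap] using hc i)
    (fun i l => by simpa [deriv_algebraMap] using hM i l) (fun i l => hinj (hsymm i l))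
    (fun i => hinj (by simpa [← deriv_algebraMap] using hr' i))
  have hvz : v = ∑ i, r₀ i * ((g₀ i)′ / g₀ i) + z := hinj (by
    rw [map_add, hz]
    simp [← deriv_algebraMap])
  rw [hvz]
  exact hadd hD

end LogarithmicDescent

theorem theorem2p2 {F : Type*} [Field F] [CharZero F] [Differential F] (v : F)
    {E : Type*} [Field E] [Differential E] [Algebra F E] [DifferentialAlgebra F E]
    (hE : IsLogarithmicExtension F E)
    (hv : ∃ D : DELExpression E (algebraMap F E v), D.IsSpecial) :
    ∃ (D : DELExpression F v) (c : Fin D.nI → F) (C : Fin D.nI → Fin D.nI → F),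
      (∀ i, (c i)′ = 0) ∧ (∀ i l, (C i l)′ = 0) ∧ (∀ i l, C i l = C l i) ∧
        ∀ i, (D.r i)′ = c i * ((1 - D.g i)′ / (1 - D.g i))
          + ∑ l, C i l * ((D.g l)′ / D.g l) := by
  obtain ⟨D, hD⟩ := hv
  have := hE.1
  exact (hE.hasSymmExpression (hD.hasSymmExpression hE)).exists_isSymmetric
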